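/- Let $S$ be a locally compact Hausdorff topological $*$-semigroup with identity (jointly continuous multiplication, continuous involution with $(xy)^*=y^*x^*$, $x^{**}=x$). Let $M(S)$ be the Banach space of bounded regular complex Borel measures on $S$ with $\|\mu\|=|\mu|(S)$, and let $L(S)$ be the set of all $\mu\in M(S)$ for which $x\mapsto|\mu|*\delta_x$ and $x\mapsto\delta_x*|\mu|$ are continuous from $S$ to $M(S)$ with its weak topology $\sigma(M(S),M(S)^*)$. Assume that $S$ is *foundation*, i.e. $\bigcup_{\mu\in L(S)}\operatorname{supp}\mu$ is dense in $S$. Let $\Sigma=\Sigma(S)$ be the family of all weakly continuous $*$-representations $\pi:S\to B(H_\pi)$ on Hilbert spaces with $\|\pi(x)\|\le1$ for all $x\in S$ (the underlying sets of the Hilbert spaces are taken in a fixed universe containing $S$), and assume that $\Sigma$ separates the points of $S$. For $\pi\in\Sigma$ and $\mu\in M(S)$ let $\tilde\pi(\mu)\in B(H_\pi)$ be the operator with $\langle\tilde\pi(\mu)\xi,\eta\rangle=\int_S\langle\pi(x)\xi,\eta\rangle\,d\mu(x)$ for $\xi,\eta\in H_\pi$. Let $C^*(S)$ be the completion of $L(S)/\{\mu:\|\mu\|_\Sigma=0\}$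 in the norm $\|\mu\|_\Sigma=\sup_{\pi\in\Sigma}\|\tilde\pi(\mu)\|$; each $\tilde\pi$ extends uniquely by continuity to a $*$-representation of $C^*(S)$, again denoted $\tilde\pi$. Let $\pi_u=\bigoplus_\pi\pi$ on $H_u=\bigoplus_\pi H_\pi$, where $\pi$ runs either (a) over all irreducible elements of $\Sigma$ (nonzero representations whose only closed invariant subspaces are $0$ and $H_\pi$), or (b) over all cyclic elements of $\Sigma$. Let $W^*(S)\subseteq B(H_u)$ be the closure of $\tilde\pi_u(C^*(S))$ in the weak operator topology. Then, in case (a) as well as in case (b), $$\pi_u(S)''=\tilde\pi_u(L(S))''=\tilde\pi_u(C^*(S))''=W^*(S),$$ where $''$ denotes the double commutant in $B(H_u)$. -/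

import Mathlib

open MeasureTheory Topology
open scoped ENNReal NNReal

universe u v

noncomputable section

namespace FoundationSemigroup

/-! ### Bounded regular complex Borel measures -/

section Measures

variable {S : Type u} [TopologicalSpace S] [T2Space S] [MeasurableSpace S] [BorelSpace S]

/-- A measure dominated by a finite inner regular measure is inner regular. -/
theorem innerRegular_of_le {μ ν : Measure S} [IsFiniteMeasure μ] [μ.InnerRegularCompactLTTop]
    (h : ν ≤ μ) : ν.InnerRegularCompactLTTop := by
  have : IsFiniteMeasure ν := isFiniteMeasure_of_le μ h
  refine ⟨fun s hs r hr => ?_⟩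
  have hpos : ν s - r ≠ 0 := (tsub_pos_of_lt hr).ne'
  obtain ⟨K, hKs, hK, hlt⟩ :=
    hs.1.exists_isCompact_sdiff_lt (μ := μ) (measure_ne_top μ s) hpos
  refine ⟨K, hKs, hK, ?_⟩
  have h1 : ν (s \ K) < ν s - r := (h _).trans_lt hlt
  have h2 : ν s ≤ ν (s \ K) + ν K := by
    calc ν s = ν ((s \ K) ∪ K) := by rw [Set.sdiff_union_of_subset hKs]
      _ ≤ _ := measure_union_le _ _
  by_contra hcon
  have h3 : ν K ≤ r := not_lt.mp hcon
  have h4 : ν s < (ν s - r) + r :=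
    h2.trans_lt (lt_of_lt_of_le
      (ENNReal.add_lt_add_right (measure_ne_top ν K) h1) (add_le_add le_rfl h3))
  rw [tsub_add_cancel_of_le hr.le] at h4
  exact lt_irrefl _ h4

variable (S) in
/-- The complex Borel measures whose total variation is finite and regular. -/
def regularMeasures : Submodule ℂ (ComplexMeasure S) where
  carrier := {μ | IsFiniteMeasure μ.variation ∧ μ.variation.Regular}
  zero_mem' := by
    simp only [Set.mem_ofPred_eq, VectorMeasure.variation_zero]
    exact ⟨inferInstance, inferInstance⟩
  add_mem' := by
    rintro μ ν ⟨h1, h2⟩ ⟨h3, h4⟩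
    have hle := VectorMeasure.variation_add_le (μ := μ) (ν := ν)
    have : IsFiniteMeasure (μ + ν).variation := isFiniteMeasure_of_le _ hle
    have := innerRegular_of_le hle
    exact ⟨inferInstance, inferInstance⟩
  smul_mem' := by
    rintro c μ ⟨h1, h2⟩
    simp only [Set.mem_ofPred_eq, VectorMeasure.variation_smul]
    exact ⟨inferInstance, inferInstance⟩

variable (S) in
/-- `M(S)`: the bounded regular complex Borel measures on `S`. -/
def M : Type u := regularMeasures S

namespace M

instance : AddCommGroup (M S) := inferInstanceAs (AddCommGroup (regularMeasures S))
instance : Module ℂ (M S) := inferInstanceAs (Module ℂ (regularMeasures S))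

/-- The underlying complex measure. -/
def val (μ : M S) : ComplexMeasure S := Subtype.val (p := (· ∈ regularMeasures S)) μ

/-- The total variation measure `|μ|`. -/
def absMeasure (μ : M S) : Measure S := μ.val.variation

instance (μ : M S) : IsFiniteMeasure μ.absMeasure := μ.2.1
instance (μ : M S) : μ.absMeasure.Regular := μ.2.2
instance (μ : M S) : IsFiniteMeasure μ.val.variation := μ.2.1

/-- The norm `‖μ‖ = |μ|(S)`. -/
instance : Norm (M S) := ⟨fun μ => μ.absMeasure.real Set.univ⟩

theorem norm_def (μ : M S) : ‖μ‖ = μ.absMeasure.real Set.univ := rfl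

theorem normCore : NormedSpace.Core ℂ (M S) where
  norm_nonneg μ := measureReal_nonneg
  norm_smul c μ := by
    change (c • μ.val).variation.real Set.univ = ‖c‖ * μ.val.variation.real Set.univ
    rw [VectorMeasure.variation_smul]
    rw [measureReal_nnreal_smul_apply, coe_nnnorm]
  norm_triangle μ ν := by
    change (μ.val + ν.val).variation.real Set.univ ≤
      μ.val.variation.real Set.univ + ν.val.variation.real Set.univ
    rw [← measureReal_add_apply]
    exact ENNReal.toReal_mono (measure_ne_top _ _)
      (VectorMeasure.variation_add_le (μ := μ.val) (ν := ν.val) Set.univ)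
  norm_eq_zero_iff μ := by
    change μ.val.variation.real Set.univ = 0 ↔ _
    rw [measureReal_eq_zero_iff, Measure.measure_univ_eq_zero, VectorMeasure.variation_eq_zero]
    exact ⟨fun h => Subtype.ext h, fun h => by rw [h]; rfl⟩

instance : NormedAddCommGroup (M S) := NormedAddCommGroup.ofCore normCore
instance : NormedSpace ℂ (M S) := NormedSpace.ofCore normCore

/-- A finite regular positive measure, seen as an element of `M(S)`. -/
def ofMeasure (ν : Measure S) [IsFiniteMeasure ν] [ν.Regular] : M S :=
  ⟨ν.toSignedMeasure.toComplexMeasure 0, by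
    have hle : (ν.toSignedMeasure.toComplexMeasure 0).variation ≤ ν := by
      refine VectorMeasure.variation_le_of_forall_enorm_le fun E hE => ?_
      have h0 : ν.toSignedMeasure.toComplexMeasure 0 E = ((ν.real E : ℝ) : ℂ) := by
        rw [SignedMeasure.toComplexMeasure_apply,
          Measure.toSignedMeasure_apply_measurable hE]
        rfl
      rw [h0, ← ofReal_norm, Complex.norm_real, Real.norm_of_nonneg measureReal_nonneg,
        ofReal_measureReal]
    have : IsFiniteMeasure (ν.toSignedMeasure.toComplexMeasure 0).variation :=
      isFiniteMeasure_of_le _ hle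
    have := innerRegular_of_le hle
    exact ⟨inferInstance, inferInstance⟩⟩

/-- `|μ|` as an element of `M(S)`. -/
def abs (μ : M S) : M S := ofMeasure μ.absMeasure

/-- The image of `μ ∈ M(S)` under a continuous map. -/
def push (μ : M S) (f : S → S) (hf : Continuous f) : M S :=
  ⟨μ.val.map f, by
    have hle := VectorMeasure.variation_map_le (μ := μ.val) (φ := f)
    have : IsFiniteMeasure (μ.val.map f).variation := isFiniteMeasure_of_le _ hle
    have : μ.val.variation.Regular := μ.2.2
    have : (μ.val.variation.map f).InnerRegularCompactLTTop :=
      Measure.InnerRegularCompactLTTop.map_of_continuous hf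
    have := innerRegular_of_le hle
    exact ⟨inferInstance, inferInstance⟩⟩

variable [Mul S] [ContinuousMul S]

/-- The convolution `μ * δ_x`: one has `∫ f d(μ * δ_x) = ∫ f(yx) dμ(y)`. -/
def mulDirac (μ : M S) (x : S) : M S := μ.push (fun y => y * x) (by fun_prop)

/-- The convolution `δ_x * μ`: one has `∫ f d(δ_x * μ) = ∫ f(xy) dμ(y)`. -/
def diracMul (x : S) (μ : M S) : M S := μ.push (fun y => x * y) (by fun_prop)

end M

variable [Mul S] [ContinuousMul S]

variable (S) in
/-- The semigroup algebra `L(S)`: those `μ ∈ M(S)` for which `x ↦ |μ| * δ_x` and `x ↦ δ_x * |μ|`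
are continuous for the weak topology `σ(M(S), M(S)*)`. -/
def L : Set (M S) :=
  {μ | Continuous (fun x : S => toWeakSpace ℂ (M S) (μ.abs.mulDirac x)) ∧
    Continuous (fun x : S => toWeakSpace ℂ (M S) (M.diracMul x μ.abs))}

variable (S) in
/-- `S` is a foundation semigroup: the supports of the measures in `L(S)` have dense union. -/
def IsFoundation : Prop := Dense (⋃ μ ∈ L S, μ.absMeasure.support)

end Measures

/-! ### Representations -/

/-- A weakly continuous `*`-representation of `S` by contractions on a Hilbert space, i.e. an
element of `Σ(S)`. -/
structure StarRep (S : Type u) [TopologicalSpace S] [Mul S] [Star S] where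
  /-- The Hilbert space. -/
  H : Type v
  [normed : NormedAddCommGroup H]
  [inner : InnerProductSpace ℂ H]
  [complete : CompleteSpace H]
  /-- The semigroup homomorphism into the bounded operators. -/
  hom : S →ₙ* (H →L[ℂ] H)
  map_star : ∀ x, hom (star x) = ContinuousLinearMap.adjoint (hom x)
  norm_le_one : ∀ x, ‖hom x‖ ≤ 1
  weak_continuous : ∀ ξ η : H, Continuous fun x => Inner.inner ℂ η (hom x ξ)

attribute [instance] StarRep.normed StarRep.inner StarRep.complete

section Representations

variable {S : Type u} [TopologicalSpace S] [Mul S] [Star S]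

variable (S) in
/-- `Σ(S)` separates the points of `S`. -/
def SeparatesPoints : Prop :=
  ∀ x y : S, x ≠ y → ∃ π : StarRep.{u, u} S, π.hom x ≠ π.hom y

namespace StarRep

/-- Topological irreducibility: `π` is not zero and has no closed invariant subspaces except
`0` and `H`. -/
def IsIrreducible (π : StarRep.{u, v} S) : Prop :=
  (∃ x, π.hom x ≠ 0) ∧
    ∀ K : Submodule ℂ π.H, IsClosed (K : Set π.H) → (∀ x, ∀ ξ ∈ K, π.hom x ξ ∈ K) →
      K = ⊥ ∨ K = ⊤

/-- `π` has a cyclic vector. -/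
def IsCyclic (π : StarRep.{u, v} S) : Prop :=
  ∃ ξ : π.H, Dense (Submodule.span ℂ (Set.range fun x => π.hom x ξ) : Set π.H)

end StarRep

/-! ### Hilbert sums of representations -/

/-- The Hilbert sum `⊕_{π ∈ ρ} H_π`. -/
abbrev HilbertSum (ρ : Set (StarRep.{u, v} S)) : Type (max u (v + 1)) :=
  lp (fun π : ρ => π.1.H) 2

/-- The Hilbert sum `⊕_{π ∈ ρ} π`. -/
@[reducible]
def sumRep (ρ : Set (StarRep.{u, v} S)) : StarRep.{u, max u (v + 1)} S where
  H := HilbertSum ρ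
  hom :=
    { toFun := fun x =>
        lp.mapCLM 2 (fun π : ρ => π.1.hom x) zero_le_one (fun π => π.1.norm_le_one x)
      map_mul' := fun x y => by
        ext ξ π
        simp }
  map_star x := by
    rw [ContinuousLinearMap.eq_adjoint_iff]
    intro ξ η
    rw [lp.inner_eq_tsum, lp.inner_eq_tsum]
    refine tsum_congr fun π => ?_
    simp [π.1.map_star, ContinuousLinearMap.adjoint_inner_left]
  norm_le_one x := lp.norm_mapCLM_le 2 _ zero_le_one fun π : ρ => π.1.norm_le_one x
  weak_continuous ξ η := by
    simp only [lp.inner_eq_tsum]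
    refine continuous_tsum (u := fun π : ρ => ‖η π‖ * ‖ξ π‖)
      (fun π => π.1.weak_continuous (ξ π) (η π)) ?_ ?_
    · have h := (lp.memℓp ξ).summable (by norm_num)
      have h' := (lp.memℓp η).summable (by norm_num)
      refine Summable.of_nonneg_of_le (fun π => by positivity) (fun π => ?_) (h'.add h)
      simp only [ENNReal.toReal_ofNat, Real.rpow_ofNat]
      nlinarith [sq_nonneg (‖η π‖ - ‖ξ π‖), sq_nonneg (‖η π‖), sq_nonneg (‖ξ π‖)]
    · intro π x
      refine (norm_inner_le_norm _ _).trans ?_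
      have : ‖π.1.hom x (ξ π)‖ ≤ ‖ξ π‖ := by
        simpa using (π.1.hom x).le_of_opNorm_le (π.1.norm_le_one x) (ξ π)
      gcongr
      exact this

end Representations

/-! ### Integrated representations and the semigroup `C*`-algebra -/

section Integrated

variable {S : Type u} [TopologicalSpace S] [T2Space S] [MeasurableSpace S] [BorelSpace S]

/-- The integral of a complex function against `μ ∈ M(S)`. -/
def M.integral (μ : M S) (f : S → ℂ) : ℂ :=
  μ.val.integral f (ContinuousLinearMap.mul ℝ ℂ)

theorem M.integral_const_mul (μ : M S) (c : ℂ) (f : S → ℂ) :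
    μ.integral (fun x => c * f x) = c * μ.integral f := by
  refine setToFun_smul _ (fun c s x => ?_) c f
  change (c * x) * μ.val s = c * (x * μ.val s)
  ring

variable [Mul S] [Star S]

namespace StarRep

variable (π : StarRep.{u, v} S) (μ : M S)

theorem integrable_coeff (ξ η : π.H) :
    μ.val.Integrable fun x => Inner.inner ℂ η (π.hom x ξ) := by
  refine Integrable.of_bound
    (π.weak_continuous ξ η).measurable.aestronglyMeasurable (‖η‖ * ‖ξ‖) ?_
  refine Filter.Eventually.of_forall fun x => (norm_inner_le_norm _ _).trans ?_
  have : ‖π.hom x ξ‖ ≤ ‖ξ‖ := by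
    simpa using (π.hom x).le_of_opNorm_le (π.norm_le_one x) ξ
  gcongr

theorem norm_integral_coeff_le (ξ η : π.H) :
    ‖μ.integral fun x => Inner.inner ℂ η (π.hom x ξ)‖ ≤ ‖μ‖ * ‖η‖ * ‖ξ‖ := by
  have hb : ∀ x, ‖Inner.inner ℂ η (π.hom x ξ)‖ ≤ ‖η‖ * ‖ξ‖ := fun x => by
    refine (norm_inner_le_norm _ _).trans ?_
    have : ‖π.hom x ξ‖ ≤ ‖ξ‖ := by
      simpa using (π.hom x).le_of_opNorm_le (π.norm_le_one x) ξ
    gcongr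
  have h := VectorMeasure.norm_integral_le_of_norm_le_const (μ := μ.val)
    (B := ContinuousLinearMap.mul ℝ ℂ) (Filter.Eventually.of_forall hb)
  have h1 : ‖ContinuousLinearMap.mul ℝ ℂ‖ ≤ 1 := ContinuousLinearMap.opNorm_mul_le ℝ ℂ
  refine h.trans ?_
  change ‖η‖ * ‖ξ‖ * ‖ContinuousLinearMap.mul ℝ ℂ‖ * ‖μ‖ ≤ _
  calc ‖η‖ * ‖ξ‖ * ‖ContinuousLinearMap.mul ℝ ℂ‖ * ‖μ‖ ≤ ‖η‖ * ‖ξ‖ * 1 * ‖μ‖ := by gcongr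
    _ = ‖μ‖ * ‖η‖ * ‖ξ‖ := by ring

/-- The sesquilinear form `(η, ξ) ↦ ∫ ⟨π(x)ξ, η⟩ dμ(x)`. -/
def form : π.H →L⋆[ℂ] π.H →L[ℂ] ℂ :=
  LinearMap.mkContinuous₂
    (LinearMap.mk₂'ₛₗ (starRingEnd ℂ) (RingHom.id ℂ)
      (fun η ξ => μ.integral fun x => Inner.inner ℂ η (π.hom x ξ))
      (fun η η' ξ => by
        simp only [inner_add_left]
        exact VectorMeasure.integral_fun_add (π.integrable_coeff μ ξ η)
          (π.integrable_coeff μ ξ η'))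
      (fun c η ξ => by
        simp only [inner_smul_left]
        exact μ.integral_const_mul _ _)
      (fun η ξ ξ' => by
        simp only [map_add, inner_add_right]
        exact VectorMeasure.integral_fun_add (π.integrable_coeff μ ξ η)
          (π.integrable_coeff μ ξ' η))
      (fun c η ξ => by
        simp only [map_smul, inner_smul_right]
        exact μ.integral_const_mul _ _))
    ‖μ‖ (fun η ξ => π.norm_integral_coeff_le μ ξ η)

/-- The integrated representation: `π̃(μ)` is the operator with
`⟨π̃(μ)ξ, η⟩ = ∫ ⟨π(x)ξ, η⟩ dμ(x)`. -/
def tilde : π.H →L[ℂ] π.H :=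
  ContinuousLinearMap.adjoint (InnerProductSpace.continuousLinearMapOfBilin (π.form μ))

/-- The defining property of `π̃(μ)` (in Mathlib the inner product is linear in the second
variable). -/
theorem inner_tilde (ξ η : π.H) :
    Inner.inner ℂ η (π.tilde μ ξ) = μ.integral fun x => Inner.inner ℂ η (π.hom x ξ) := by
  rw [tilde, ContinuousLinearMap.adjoint_inner_right,
    InnerProductSpace.continuousLinearMapOfBilin_apply]
  rfl

theorem norm_tilde_le : ‖π.tilde μ‖ ≤ ‖μ‖ := by
  refine ContinuousLinearMap.opNorm_le_bound _ (norm_nonneg _) fun ξ => ?_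
  have h := π.norm_integral_coeff_le μ ξ (π.tilde μ ξ)
  rw [← π.inner_tilde μ, inner_self_eq_norm_sq_to_K] at h
  by_cases h0 : ‖π.tilde μ ξ‖ = 0
  · rw [h0]; positivity
  · have h1 : 0 < ‖π.tilde μ ξ‖ := lt_of_le_of_ne (norm_nonneg _) (Ne.symm h0)
    simp only [norm_pow, Complex.coe_algebraMap, Complex.norm_real, norm_norm] at h
    nlinarith

end StarRep

variable (S) in
/-- The bounded product `∏_{π ∈ Σ(S)} B(H_π)` with the supremum norm. -/
abbrev BoundedProduct : Type (u + 1) :=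
  lp (fun π : StarRep.{u, u} S => π.H →L[ℂ] π.H) ∞

instance : NonUnitalCStarAlgebra (BoundedProduct S) := inferInstance
instance : NonUnitalRing (BoundedProduct S) := inferInstance
instance : NonUnitalSemiring (BoundedProduct S) := inferInstance

/-- The family `(π̃(μ))_{π ∈ Σ(S)}`. Its norm is `‖μ‖_Σ = sup_π ‖π̃(μ)‖`, so that this map induces
an isometry of `(L(S)/I_Σ, ‖·‖_Σ)` onto the image of `L(S)`. -/
def tildeFamily (μ : M S) : BoundedProduct S :=
  ⟨fun π => π.tilde μ, memℓp_infty ⟨‖μ‖, by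
    rintro _ ⟨π, rfl⟩
    exact π.norm_tilde_le μ⟩⟩

variable [ContinuousMul S]

variable (S) in
/-- The full semigroup `C*`-algebra `C*(S)`: the completion of `L(S)/I_Σ` for `‖·‖_Σ`, realized as
the closed `*`-algebra generated by the image of `L(S)` in the bounded product (that image is a
`*`-algebra, so this is its closure). -/
def CStar : NonUnitalStarSubalgebra ℂ (BoundedProduct S) :=
  (NonUnitalStarAlgebra.adjoin ℂ (tildeFamily '' L S)).topologicalClosure

/-- The extension to `C*(S)` of the integrated form of `⊕_{π ∈ ρ} π`. The extension of a single
`π̃` to `C*(S)` is the coordinate `a ↦ a π`. -/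
def extend (ρ : Set (StarRep.{u, u} S)) (a : CStar S) : HilbertSum ρ →L[ℂ] HilbertSum ρ :=
  lp.mapCLM 2 (fun π : ρ => (a : BoundedProduct S) π.1) (norm_nonneg (a : BoundedProduct S))
    (fun π => lp.norm_apply_le_norm ENNReal.top_ne_zero (a : BoundedProduct S) π.1)

/-- `extend ρ` does extend the integrated form of `⊕_{π ∈ ρ} π` from `L(S)` to `C*(S)`. -/
theorem extend_tildeFamily (ρ : Set (StarRep.{u, u} S)) (μ : M S) (h : tildeFamily μ ∈ CStar S) :
    extend ρ ⟨tildeFamily μ, h⟩ = (sumRep ρ).tilde μ := by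
  classical
  refine lp.ext_continuousLinearMap (by norm_num) fun π => ?_
  ext1 ξ
  have hsingle : ∀ (T : ∀ π : ρ, π.1.H →L[ℂ] π.1.H) (K : ℝ) (hK : 0 ≤ K)
      (hT : ∀ π, ‖T π‖ ≤ K), lp.mapCLM 2 T hK hT (lp.single 2 π ξ) = lp.single 2 π (T π ξ) := by
    intro T K hK hT
    ext σ
    by_cases hσ : σ = π
    · subst hσ; simp
    · simp [Pi.single_eq_of_ne hσ]
  refine ext_inner_left ℂ fun η => ?_
  change Inner.inner ℂ η (extend ρ ⟨tildeFamily μ, h⟩ (lp.single 2 π ξ)) =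
    Inner.inner ℂ η ((sumRep ρ).tilde μ (lp.single 2 π ξ))
  refine Eq.trans ?_ ((sumRep ρ).inner_tilde μ (lp.single 2 π ξ) η).symm
  rw [extend, hsingle, lp.inner_single_right]
  change Inner.inner ℂ (η π) (π.1.tilde μ ξ) = _
  rw [StarRep.inner_tilde]
  congr 1
  ext x
  have hx : (sumRep ρ).hom x (lp.single 2 π ξ) = lp.single 2 π (π.1.hom x ξ) :=
    hsingle (fun π : ρ => π.1.hom x) 1 zero_le_one (fun π => π.1.norm_le_one x)
  rw [hx, lp.inner_single_right]

/-! ### The operators in a universal representation -/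

/-- The operators `π_ρ(s)`, `s ∈ S`, where `π_ρ = ⊕_{π ∈ ρ} π`. -/
def semigroupOps (ρ : Set (StarRep.{u, u} S)) : Set (HilbertSum ρ →L[ℂ] HilbertSum ρ) :=
  Set.range fun s : S => (sumRep ρ).hom s

/-- The operators `π̃_ρ(μ)`, `μ ∈ L(S)`. -/
def measureOps (ρ : Set (StarRep.{u, u} S)) : Set (HilbertSum ρ →L[ℂ] HilbertSum ρ) :=
  (fun μ : M S => (sumRep ρ).tilde μ) '' L S

/-- The operators `π̃_ρ(a)`, `a ∈ C*(S)`. -/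
def cstarOps (ρ : Set (StarRep.{u, u} S)) : Set (HilbertSum ρ →L[ℂ] HilbertSum ρ) :=
  Set.range fun a : CStar S => extend ρ a

/-- The von Neumann algebra `W*(S)` on `⊕_{π ∈ ρ} H_π`: the closure of `π̃_ρ(C*(S))` in the weak
operator topology. It is the enveloping `W*`-algebra of `C*(S)` when `π_ρ` is universal. -/
def WStar (ρ : Set (StarRep.{u, u} S)) : Set (HilbertSum ρ →L[ℂ] HilbertSum ρ) :=
  {T | ContinuousLinearMapWOT.ofCLM T ∈ closure (ContinuousLinearMapWOT.ofCLM '' cstarOps ρ)}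

end Integrated

section Universal

variable (S : Type u) [TopologicalSpace S] [Mul S] [Star S]

/-- `Σ₀(S)`: the irreducible elements of `Σ(S)`. -/
def irreducibles : Set (StarRep.{u, u} S) := {π | π.IsIrreducible}

/-- The cyclic elements of `Σ(S)`. -/
def cyclics : Set (StarRep.{u, u} S) := {π | π.IsCyclic}

end Universal

/-- The double commutant `A''` in `B(H)`. -/
abbrev bicommutant {H : Type v} [NormedAddCommGroup H] [InnerProductSpace ℂ H]
    (A : Set (H →L[ℂ] H)) : Set (H →L[ℂ] H) :=
  Set.centralizer (Set.centralizer A)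

end FoundationSemigroup

end

/-!
Replacing `μ ∈ L(S)` by `u • |μ|` with `|u| = 1` stays in `L(S)`, since membership depends only on
`|μ|`. Choosing the phase `u` suitably, `∫ f dν = 0` for all `ν ∈ L(S)` forces `f = 0` on every
`supp μ`, hence everywhere when `S` is foundation: `L(S)` separates bounded continuous functions.
Applied to the coefficients `⟨π(x)ξ, η⟩`, this shows that `π(S)` and `π̃(L(S))` have the same
commutant and annihilate the same vectors. As `C*(S)` is generated by `L(S)` as a closed
`*`-algebra, its commutant is the same again. Cyclic and irreducible representations are
nondegenerate, so von Neumann's double commutant theorem identifies the bicommutant with the weak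
operator closure.
-/

noncomputable section

namespace FoundationSemigroup

section Density

variable {X E F G : Type*} [MeasurableSpace X] {m : Measure X} [NormedAddCommGroup E]
  [NormedSpace ℝ E] [NormedAddCommGroup F] [NormedSpace ℝ F] [NormedAddCommGroup G]
  [NormedSpace ℝ G] (B : E →L[ℝ] F →L[ℝ] G) {f : X → E} {u : X → F}

theorem integrable_bilin_of_withDensity_enorm (hu : AEStronglyMeasurable u m)
    (hf : Integrable f (m.withDensity (‖u ·‖ₑ))) : Integrable (fun x => B (f x) (u x)) m := by
  have hf' : Integrable (fun x => ‖u x‖ • f x) m := by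
    simpa using (integrable_withDensity_iff_integrable_smul₀' hu.enorm (by simp)).1 hf
  have hphase : ∀ x, ‖‖u x‖⁻¹ • u x‖ ≤ 1 := fun x => by
    rw [norm_smul, norm_inv, norm_norm]
    exact inv_mul_le_one
  refine (B.integrable_of_bilin_of_bdd_right 1 hf'
    (hu.norm.aemeasurable.inv.aestronglyMeasurable.smul hu) (.of_forall hphase)).congr
    (.of_forall fun x => ?_)
  rcases eq_or_ne (u x) 0 with h | h
  · simp [h]
  · simp [smul_smul, h]

theorem norm_integral_bilin_le_of_withDensity_enorm (hu : AEStronglyMeasurable u m)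
    (hf : Integrable f (m.withDensity (‖u ·‖ₑ))) :
    ‖∫ x, B (f x) (u x) ∂m‖ ≤ ‖B‖ * ∫ x, ‖f x‖ ∂m.withDensity (‖u ·‖ₑ) := by
  have hf' := (integrable_withDensity_iff_integrable_smul₀' hu.enorm (by simp)).1 hf.norm
  rw [integral_withDensity_eq_integral_toReal_smul₀ hu.enorm (by simp), ← integral_const_mul]
  refine norm_integral_le_of_norm_le (hf'.const_mul _) (.of_forall fun x => ?_)
  calc ‖B (f x) (u x)‖ ≤ ‖B‖ * ‖f x‖ * ‖u x‖ := B.le_opNorm₂ _ _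
    _ = ‖B‖ * (‖u x‖ₑ.toReal • ‖f x‖) := by
      rw [toReal_enorm, smul_eq_mul]
      ring

theorem integral_withDensityᵥ [CompleteSpace F] [CompleteSpace G] (hu : Integrable u m)
    (hf : (m.withDensityᵥ u).Integrable f) :
    ∫ᵛ x, f x ∂[B; m.withDensityᵥ u] = ∫ x, B (f x) (u x) ∂m := by
  have hvar : (m.withDensityᵥ u).variation = m.withDensity (‖u ·‖ₑ) :=
    Measure.variation_withDensityᵥ hu
  have : IsFiniteMeasure (m.withDensityᵥ u).variation := by
    rw [hvar]
    exact isFiniteMeasure_withDensity hu.2.ne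
  have hB {g : X → E} (hg : (m.withDensityᵥ u).Integrable g) :
      Integrable (fun x => B (g x) (u x)) m :=
    integrable_bilin_of_withDensity_enorm B hu.1 (hvar ▸ hg)
  revert f
  refine Integrable.induction _ (fun c s hs _ => ?_) (fun f g _ hf hg ihf ihg => ?_) ?_
    fun f g hfg _ ih => ?_
  · rw [VectorMeasure.integral_indicator_const _ hs, withDensityᵥ_apply hu hs,
      ← (B c).integral_comp_comm hu.restrict, ← integral_indicator hs]
    congr 1 with x
    by_cases hx : x ∈ s <;> simp [hx]
  · rw [VectorMeasure.integral_add hf hg, ihf, ihg, ← integral_add (hB hf) (hB hg)]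
    simp
  · refine isClosed_eq VectorMeasure.continuous_integral ?_
    refine (LipschitzWith.of_dist_le_mul (K := ‖B‖₊) fun f g => ?_).continuous
    have hf := L1.integrable_coeFn f
    have hg := L1.integrable_coeFn g
    rw [dist_eq_norm, ← integral_sub (hB hf) (hB hg), L1.dist_eq_integral_dist]
    have hfg : Integrable (fun x => f x - g x) (m.withDensity (‖u ·‖ₑ)) := by
      rw [← hvar]
      exact hf.sub hg
    simpa only [hvar, dist_eq_norm, coe_nnnorm, map_sub, sub_apply] using
      norm_integral_bilin_le_of_withDensity_enorm B hu.1 hfg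
  · rw [← VectorMeasure.integral_congr_ae hfg, ih]
    rw [hvar, Filter.EventuallyEq, ae_withDensity_iff' hu.1.enorm] at hfg
    refine integral_congr_ae ?_
    filter_upwards [hfg] with x hx
    rcases eq_or_ne (u x) 0 with h | h
    · simp [h]
    · rw [hx (by simpa using h)]

end Density

section Measures

variable {S : Type u} [TopologicalSpace S] [T2Space S] [MeasurableSpace S] [BorelSpace S]

namespace M

theorem abs_congr {μ ν : M S} (h : μ.absMeasure = ν.absMeasure) : μ.abs = ν.abs :=
  Subtype.ext (congrArg (fun τ : SignedMeasure S => τ.toComplexMeasure 0)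
    (Measure.toSignedMeasure_congr h))

section UnimodularDensity

variable (μ : M S) {u : S → ℂ} (hu : Measurable u) (hnorm : ∀ x, ‖u x‖ = 1)
include hu hnorm

theorem integrable_of_unimodular : Integrable u μ.absMeasure :=
  .of_bound hu.aestronglyMeasurable 1 (.of_forall fun x => (hnorm x).le)

theorem variation_withDensityᵥ_unimodular :
    (μ.absMeasure.withDensityᵥ u).variation = μ.absMeasure := by
  have henorm : (‖u ·‖ₑ) = 1 := funext fun x => by simp [← ofReal_norm, hnorm]
  rw [Measure.variation_withDensityᵥ (μ.integrable_of_unimodular hu hnorm), henorm,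
    withDensity_one]

/-- The measure `u • |μ|` for a measurable function `u` of modulus one; its total variation
measure is again `|μ|`. -/
def unimodularDensity : M S :=
  ⟨μ.absMeasure.withDensityᵥ u, by
    change IsFiniteMeasure _ ∧ Measure.Regular _
    rw [μ.variation_withDensityᵥ_unimodular hu hnorm]
    exact ⟨inferInstance, inferInstance⟩⟩

theorem absMeasure_unimodularDensity :
    (μ.unimodularDensity hu hnorm).absMeasure = μ.absMeasure :=
  μ.variation_withDensityᵥ_unimodular hu hnorm

theorem integral_unimodularDensity {f : S → ℂ} (hf : Integrable f μ.absMeasure) :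
    (μ.unimodularDensity hu hnorm).integral f = ∫ x, f x * u x ∂μ.absMeasure := by
  refine integral_withDensityᵥ (.mul ℝ ℂ) (μ.integrable_of_unimodular hu hnorm) ?_
  rwa [VectorMeasure.Integrable, μ.variation_withDensityᵥ_unimodular hu hnorm]

end UnimodularDensity

end M

variable [Mul S] [ContinuousMul S]

theorem mem_L_congr {μ ν : M S} (h : μ.absMeasure = ν.absMeasure) : μ ∈ L S ↔ ν ∈ L S := by
  simp only [L, Set.mem_ofPred_eq, M.abs_congr h]

theorem exists_mem_L_integral_eq_integral_norm {μ : M S} (hμ : μ ∈ L S) {f : S → ℂ}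
    (hmeas : Measurable f) (hint : Integrable f μ.absMeasure) :
    ∃ ν ∈ L S, ν.integral f = ∫ x, ‖f x‖ ∂μ.absMeasure := by
  have hu : Measurable fun x => Complex.exp (-(f x).arg * Complex.I) := by fun_prop
  have hnorm (x : S) : ‖Complex.exp (-(f x).arg * Complex.I)‖ = 1 := by
    simpa using Complex.norm_exp_ofReal_mul_I (-(f x).arg)
  refine ⟨μ.unimodularDensity hu hnorm,
    (mem_L_congr (μ.absMeasure_unimodularDensity hu hnorm)).2 hμ, ?_⟩
  rw [μ.integral_unimodularDensity hu hnorm hint, ← integral_complex_ofReal]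
  refine integral_congr_ae (.of_forall fun x => ?_)
  calc f x * Complex.exp (-(f x).arg * Complex.I)
      = ‖f x‖ * Complex.exp ((f x).arg * Complex.I) * Complex.exp (-(f x).arg * Complex.I) := by
        rw [Complex.norm_mul_exp_arg_mul_I]
    _ = ‖f x‖ := by
        rw [mul_assoc, ← Complex.exp_add, neg_mul, add_neg_cancel, Complex.exp_zero, mul_one]

open scoped BoundedContinuousFunction in
theorem IsFoundation.eq_zero_of_integral_eq_zero (hS : IsFoundation S) {f : S →ᵇ ℂ}
    (hf : ∀ μ ∈ L S, μ.integral f = 0) : f = 0 := by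
  have hvanish : ∀ μ ∈ L S, ∀ x ∈ μ.absMeasure.support, f x = 0 := by
    intro μ hμ x hx
    have hint : Integrable f μ.absMeasure := f.integrable _
    obtain ⟨ν, hν, hνf⟩ :=
      exists_mem_L_integral_eq_integral_norm hμ f.continuous.measurable hint
    rw [hf ν hν, eq_comm, Complex.ofReal_eq_zero,
      integral_eq_zero_iff_of_nonneg (fun _ => norm_nonneg _) hint.norm] at hνf
    by_contra hfx
    refine ((Measure.mem_support_iff_forall x).1 hx _
      ((isOpen_ne_fun f.continuous continuous_const).mem_nhds hfx)).ne' ?_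
    simpa using ae_iff.1 hνf
  refine DFunLike.coe_injective (f.continuous.ext_on hS continuous_const ?_)
  intro x hx
  simp only [Set.mem_iUnion, exists_prop] at hx
  obtain ⟨μ, hμ, hx⟩ := hx
  exact hvanish μ hμ x hx

open scoped BoundedContinuousFunction in
theorem IsFoundation.eq_of_integral_eq (hS : IsFoundation S) {f g : S →ᵇ ℂ}
    (hfg : ∀ μ ∈ L S, μ.integral f = μ.integral g) : f = g := by
  refine sub_eq_zero.1 (hS.eq_zero_of_integral_eq_zero fun μ hμ => ?_)
  rw [← sub_eq_zero.2 (hfg μ hμ)]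
  exact VectorMeasure.integral_fun_sub (f.integrable _) (g.integrable _)

end Measures

section HilbertSum

open ContinuousLinearMap

variable {𝕜 ι : Type*} [RCLike 𝕜] {E : ι → Type*} [∀ i, NormedAddCommGroup (E i)]
  [∀ i, InnerProductSpace 𝕜 (E i)]

theorem mapCLM_single [DecidableEq ι] (T : ∀ i, E i →L[𝕜] E i) {C : ℝ} (hC : 0 ≤ C)
    (hT : ∀ i, ‖T i‖ ≤ C) (i : ι) (x : E i) :
    lp.mapCLM 2 T hC hT (lp.single 2 i x) = lp.single 2 i (T i x) := by
  ext j
  rcases eq_or_ne j i with rfl | hj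
  · simp
  · simp [Pi.single_eq_of_ne hj]

variable [∀ i, CompleteSpace (E i)] {A : Type*} [NonUnitalSeminormedRing A] [Star A] [Module 𝕜 A]

/-- The Hilbert sum of a family of contractive `*`-representations of `A`, acting on the Hilbert
sum of the underlying spaces. -/
def directSumHom (φ : ∀ i, A →⋆ₙₐ[𝕜] (E i →L[𝕜] E i)) (hφ : ∀ i a, ‖φ i a‖ ≤ ‖a‖) :
    A →⋆ₙₐ[𝕜] (lp E 2 →L[𝕜] lp E 2) where
  toFun a := lp.mapCLM 2 (fun i => φ i a) (norm_nonneg a) (fun i => hφ i a)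
  map_smul' c a := by ext; simp
  map_zero' := by ext; simp
  map_add' a b := by ext; simp
  map_mul' a b := by ext; simp
  map_star' a := by
    rw [star_eq_adjoint, eq_adjoint_iff]
    intro ξ η
    rw [lp.inner_eq_tsum, lp.inner_eq_tsum]
    refine tsum_congr fun i => ?_
    simp [map_star, star_eq_adjoint, adjoint_inner_left]

@[simp]
theorem directSumHom_apply_apply (φ : ∀ i, A →⋆ₙₐ[𝕜] (E i →L[𝕜] E i))
    (hφ : ∀ i a, ‖φ i a‖ ≤ ‖a‖) (a : A) (ξ : lp E 2) (i : ι) :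
    directSumHom φ hφ a ξ i = φ i a (ξ i) := by
  simp [directSumHom]

theorem continuous_directSumHom (φ : ∀ i, A →⋆ₙₐ[𝕜] (E i →L[𝕜] E i))
    (hφ : ∀ i a, ‖φ i a‖ ≤ ‖a‖) : Continuous (directSumHom φ hφ) :=
  AddMonoidHomClass.continuous_of_bound (directSumHom φ hφ) 1 fun a => by
    rw [one_mul]
    exact lp.norm_mapCLM_le 2 _ (norm_nonneg a) fun i => hφ i a

end HilbertSum

section WeakOperatorTopology

variable {𝕜 E F : Type*} [RCLike 𝕜] [NormedAddCommGroup E] [NormedSpace 𝕜 E]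
  [NormedAddCommGroup F] [NormedSpace 𝕜 F]

/-- A set of operators is nondegenerate if no nonzero vector is annihilated by all its members;
for self-adjoint sets this is equivalent to density of the span of all ranges. -/
def IsNondegenerate (B : Set (E →L[𝕜] E)) : Prop :=
  ∀ x : E, (∀ a ∈ B, a x = 0) → x = 0

theorem IsNondegenerate.mono {B C : Set (E →L[𝕜] E)} (hB : IsNondegenerate B) (h : B ⊆ C) :
    IsNondegenerate C :=
  fun x hx => hB x fun a ha => hx a (h ha)

theorem mem_closure_wot_of_forall_finset {B : Set (E →L[𝕜] F)} {T : E →L[𝕜] F}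
    (h : ∀ (s : Finset E) (ε : ℝ), 0 < ε → ∃ a ∈ B, ∀ x ∈ s, ‖a x - T x‖ < ε) :
    ContinuousLinearMapWOT.ofCLM T ∈ closure (ContinuousLinearMapWOT.ofCLM '' B) := by
  classical
  rw [mem_closure_iff_nhds]
  intro U hU
  obtain ⟨s, r, hr, hball⟩ := (ContinuousLinearMapWOT.withSeminorms.mem_nhds_iff _ _).1 hU
  let C : ℝ := 1 + ∑ p ∈ s, ‖p.2‖
  have hC : 0 < C := by positivity
  obtain ⟨a, ha, hlt⟩ := h (s.image Prod.fst) (r / C) (div_pos hr hC)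
  refine ⟨.ofCLM a, hball ?_, a, ha, rfl⟩
  rw [Seminorm.mem_ball]
  refine Seminorm.finset_sup_apply_lt hr fun p hp => ?_
  have hpC : ‖p.2‖ < C :=
    (Finset.single_le_sum (fun q _ => norm_nonneg q.2) hp).trans_lt (lt_one_add _)
  have hap : ‖a p.1 - T p.1‖ < r / C := hlt _ (Finset.mem_image_of_mem _ hp)
  calc ‖p.2 (a p.1 - T p.1)‖ ≤ ‖p.2‖ * ‖a p.1 - T p.1‖ := p.2.le_opNorm _
    _ ≤ C * ‖a p.1 - T p.1‖ := by gcongr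
    _ < C * (r / C) := by gcongr
    _ = r := mul_div_cancel₀ r hC.ne'

theorem mem_bicommutant_of_mem_closure_wot {B : Set (E →L[𝕜] E)} {T : E →L[𝕜] E}
    (hT : ContinuousLinearMapWOT.ofCLM T ∈ closure (ContinuousLinearMapWOT.ofCLM '' B)) :
    T ∈ Set.centralizer (Set.centralizer B) := by
  have hB : ContinuousLinearMapWOT.ofCLM '' B ⊆
      Set.centralizer (ContinuousLinearMapWOT.ofCLM '' Set.centralizer B) := by
    rintro _ ⟨b, hb, rfl⟩ _ ⟨c, hc, rfl⟩
    exact congrArg ContinuousLinearMapWOT.ofCLM (hc b hb).symm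
  exact fun c hc => ContinuousLinearMapWOT.ofCLM_injective
    (closure_minimal hB (Set.isClosed_centralizer _) hT _ ⟨c, hc, rfl⟩)

end WeakOperatorTopology

section DoubleCommutant

open ContinuousLinearMap

variable {𝕜 H : Type*} [RCLike 𝕜] [NormedAddCommGroup H] [InnerProductSpace 𝕜 H]

section Amplification

variable {ι : Type*}

/-- The `(i, j)` entry of an operator on `ℓ²(ι, H)`, viewed as an infinite operator matrix. -/
def matrixEntry [DecidableEq ι] (P : lp (fun _ : ι => H) 2 →L[𝕜] lp (fun _ : ι => H) 2)
    (i j : ι) : H →L[𝕜] H :=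
  lp.evalCLM 𝕜 (fun _ : ι => H) 2 i ∘L P ∘L lp.singleContinuousLinearMap 𝕜 (fun _ : ι => H) 2 j

theorem matrixEntry_injective [DecidableEq ι]
    {P Q : lp (fun _ : ι => H) 2 →L[𝕜] lp (fun _ : ι => H) 2}
    (h : ∀ i j, matrixEntry P i j = matrixEntry Q i j) : P = Q := by
  refine lp.ext_continuousLinearMap (by norm_num) fun j => ?_
  ext x i
  exact DFunLike.congr_fun (h i j) x

variable [CompleteSpace H]

variable (𝕜 H ι) in
/-- The amplification `T ↦ T ⊕ T ⊕ ⋯` from operators on `H` to operators on `ℓ²(ι, H)`. -/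
def amplification :
    (H →L[𝕜] H) →⋆ₙₐ[𝕜] (lp (fun _ : ι => H) 2 →L[𝕜] lp (fun _ : ι => H) 2) :=
  directSumHom (fun _ => .id 𝕜 _) fun _ _ => le_rfl

@[simp]
theorem amplification_apply_apply (T : H →L[𝕜] H) (ξ : lp (fun _ : ι => H) 2) (i : ι) :
    amplification 𝕜 H ι T ξ i = T (ξ i) :=
  directSumHom_apply_apply _ _ T ξ i

theorem amplification_single [DecidableEq ι] (T : H →L[𝕜] H) (j : ι) (x : H) :
    amplification 𝕜 H ι T (lp.single 2 j x) = lp.single 2 j (T x) :=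
  mapCLM_single (fun _ => T) (norm_nonneg T) (fun _ => le_rfl) j x

theorem IsNondegenerate.image_amplification {B : Set (H →L[𝕜] H)} (hB : IsNondegenerate B) :
    IsNondegenerate (amplification 𝕜 H ι '' B) := by
  intro ξ hξ
  ext i
  refine hB _ fun a ha => ?_
  rw [← amplification_apply_apply, hξ _ ⟨a, ha, rfl⟩]
  rfl

theorem commute_amplification_iff [DecidableEq ι]
    {P : lp (fun _ : ι => H) 2 →L[𝕜] lp (fun _ : ι => H) 2} {T : H →L[𝕜] H} :
    Commute P (amplification 𝕜 H ι T) ↔ ∀ i j, Commute (matrixEntry P i j) T := by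
  have hright : ∀ i j, matrixEntry (P * amplification 𝕜 H ι T) i j = matrixEntry P i j * T := by
    intro i j
    ext x
    exact congrArg (fun ξ => P ξ i) (amplification_single T j x)
  have hleft : ∀ i j, matrixEntry (amplification 𝕜 H ι T * P) i j = T * matrixEntry P i j :=
    fun i j => ext fun x => amplification_apply_apply T _ i
  refine ⟨fun h i j => ?_, fun h => matrixEntry_injective fun i j => ?_⟩
  · rw [Commute, SemiconjBy, ← hright, ← hleft, h.eq]
  · rw [hright, hleft, (h i j).eq]

theorem amplification_mem_bicommutant {B : Set (H →L[𝕜] H)} {T : H →L[𝕜] H}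
    (hT : T ∈ Set.centralizer (Set.centralizer B)) :
    amplification 𝕜 H ι T ∈ Set.centralizer (Set.centralizer (amplification 𝕜 H ι '' B)) := by
  classical
  intro P hP
  refine commute_amplification_iff.2 fun i j => hT _ fun a ha => ?_
  exact (commute_amplification_iff.1 (hP _ ⟨a, ha, rfl⟩).symm i j).symm

end Amplification

variable [CompleteSpace H]

theorem commute_starProjection {T : H →L[𝕜] H} {K : Submodule 𝕜 H} [K.HasOrthogonalProjection]
    (hT : ∀ x ∈ K, T x ∈ K) (hTstar : ∀ x ∈ K, star T x ∈ K) : Commute K.starProjection T := by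
  rw [IsIdempotentElem.commute_iff K.isIdempotentElem_starProjection,
    Submodule.range_starProjection, Submodule.ker_starProjection]
  exact ⟨hT, orthogonal_mem_invtSubmodule hTstar⟩

theorem apply_mem_closure_of_mem_bicommutant {A : NonUnitalStarSubalgebra 𝕜 (H →L[𝕜] H)}
    (hA : IsNondegenerate (A : Set (H →L[𝕜] H))) {T : H →L[𝕜] H}
    (hT : T ∈ Set.centralizer (Set.centralizer (A : Set (H →L[𝕜] H)))) (x : H) :
    T x ∈ closure ((fun a : H →L[𝕜] H => a x) '' A) := by
  let K₀ : Submodule 𝕜 H := A.toSubmodule.map (apply 𝕜 H x).toLinearMap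
  let K := K₀.topologicalClosure
  have horbit : ∀ a ∈ A, a x ∈ K := fun a ha => K₀.le_topologicalClosure ⟨a, ha, rfl⟩
  have hinvariant : ∀ a ∈ A, ∀ y ∈ K, a y ∈ K := by
    refine fun a ha y hy => map_mem_closure a.continuous hy ?_
    rintro _ ⟨b, hb, rfl⟩
    exact ⟨a * b, mul_mem (s := A) ha hb, rfl⟩
  have hP : ∀ a ∈ A, Commute K.starProjection a := fun a ha =>
    commute_starProjection (hinvariant a ha) (hinvariant _ (star_mem (s := A) ha))
  have hx : K.starProjection x = x := by
    refine (sub_eq_zero.1 (hA _ fun a ha => ?_)).symm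
    have h : K.starProjection (a x) = a (K.starProjection x) :=
      DFunLike.congr_fun (hP a ha).eq x
    rw [map_sub, ← h, Submodule.starProjection_eq_self_iff.2 (horbit a ha), sub_self]
  have hTx : K.starProjection (T x) = T x := by
    have h : K.starProjection (T x) = T (K.starProjection x) :=
      DFunLike.congr_fun (hT K.starProjection fun a ha => (hP a ha).symm) x
    rw [h, hx]
  exact Submodule.starProjection_eq_self_iff.1 hTx

-- Finitely many vectors of `H` are the coordinates of one vector of `ℓ²(s, H)`, which reduces the
-- claim to a single vector and the amplified algebra.
theorem exists_norm_sub_lt_of_mem_bicommutant {A : NonUnitalStarSubalgebra 𝕜 (H →L[𝕜] H)}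
    (hA : IsNondegenerate (A : Set (H →L[𝕜] H))) {T : H →L[𝕜] H}
    (hT : T ∈ Set.centralizer (Set.centralizer (A : Set (H →L[𝕜] H)))) (s : Finset H) {ε : ℝ}
    (hε : 0 < ε) : ∃ a ∈ A, ∀ x ∈ s, ‖a x - T x‖ < ε := by
  let ξ : lp (fun _ : s => H) 2 := ⟨fun x => x, Memℓp.all _⟩
  have hmem := apply_mem_closure_of_mem_bicommutant (A := A.map (amplification 𝕜 H s))
    hA.image_amplification (amplification_mem_bicommutant hT) ξ
  obtain ⟨_, ⟨_, ⟨a, ha, rfl⟩, rfl⟩, hlt⟩ := Metric.mem_closure_iff.1 hmem ε hε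
  refine ⟨a, ha, fun x hx => ?_⟩
  calc ‖a x - T x‖ = ‖(amplification 𝕜 H s a ξ - amplification 𝕜 H s T ξ) ⟨x, hx⟩‖ := by simp [ξ]
    _ ≤ ‖amplification 𝕜 H s a ξ - amplification 𝕜 H s T ξ‖ :=
      lp.norm_apply_le_norm two_ne_zero _ _
    _ < ε := by
      rw [← dist_eq_norm, dist_comm]
      exact hlt

theorem bicommutant_eq_wotClosure {A : NonUnitalStarSubalgebra 𝕜 (H →L[𝕜] H)}
    (hA : IsNondegenerate (A : Set (H →L[𝕜] H))) :
    Set.centralizer (Set.centralizer (A : Set (H →L[𝕜] H))) =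
      {T | ContinuousLinearMapWOT.ofCLM T ∈
        closure (ContinuousLinearMapWOT.ofCLM '' (A : Set (H →L[𝕜] H)))} := by
  ext T
  exact ⟨fun hT => mem_closure_wot_of_forall_finset fun s ε hε =>
    exists_norm_sub_lt_of_mem_bicommutant hA hT s hε, mem_bicommutant_of_mem_closure_wot⟩

end DoubleCommutant

section Representations

open ContinuousLinearMap
open scoped BoundedContinuousFunction

variable {S : Type u} [TopologicalSpace S] [Mul S] [Star S]

namespace StarRep

variable (π : StarRep.{u, v} S)

/-- The matrix coefficient `x ↦ ⟨π(x)ξ, η⟩`. -/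
def coeff (ξ η : π.H) : S →ᵇ ℂ :=
  .ofNormedAddCommGroup (fun x => Inner.inner ℂ η (π.hom x ξ)) (π.weak_continuous ξ η)
    (‖η‖ * ‖ξ‖) fun x => (norm_inner_le_norm _ _).trans <| by
      gcongr
      exact (le_of_opNorm_le _ (π.norm_le_one x) ξ).trans_eq (one_mul _)

variable {π}

theorem star_mem_centralizer_range_hom {T : π.H →L[ℂ] π.H}
    (hT : T ∈ Set.centralizer (Set.range π.hom)) :
    star T ∈ Set.centralizer (Set.range π.hom) := by
  rintro _ ⟨x, rfl⟩
  have h : Commute (star (π.hom x)) T := by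
    rw [star_eq_adjoint, ← π.map_star]
    exact hT _ ⟨star x, rfl⟩
  exact commute_star_comm.1 h

theorem IsCyclic.isNondegenerate (h : π.IsCyclic) : IsNondegenerate (Set.range π.hom) := by
  obtain ⟨ζ, hζ⟩ := h
  intro ξ hξ
  refine hζ.eq_zero_of_inner_left ℂ fun v hv => ?_
  induction hv using Submodule.span_induction with
  | mem v hv =>
    obtain ⟨x, rfl⟩ := hv
    rw [← adjoint_inner_left, ← π.map_star, hξ _ ⟨star x, rfl⟩, inner_zero_left]
  | zero => exact inner_zero_right ξ
  | add v w _ _ hv hw => rw [inner_add_right, hv, hw, add_zero]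
  | smul c v _ hv => rw [inner_smul_right, hv, mul_zero]

theorem IsIrreducible.isNondegenerate (h : π.IsIrreducible) :
    IsNondegenerate (Set.range π.hom) := by
  obtain ⟨⟨x, hx⟩, hinvariant⟩ := h
  let K : Submodule ℂ π.H := ⨅ y, (π.hom y).ker
  have hK {ξ : π.H} : ξ ∈ K ↔ ∀ y, π.hom y ξ = 0 := by simp [K]
  have hclosed : IsClosed (K : Set π.H) := by
    rw [Submodule.coe_iInf]
    exact isClosed_iInter fun y => (π.hom y).isClosed_ker
  rcases hinvariant K hclosed fun y ξ hξ => by rw [hK.1 hξ y]; exact zero_mem K with hbot | htop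
  · intro ξ hξ
    have hξK : ξ ∈ K := hK.2 fun y => hξ _ ⟨y, rfl⟩
    simpa [hbot] using hξK
  · exact absurd (ContinuousLinearMap.ext fun ξ => hK.1 (htop ▸ Submodule.mem_top) x) hx

theorem isNondegenerate_sumRep {ρ : Set (StarRep.{u, v} S)}
    (hρ : ∀ π ∈ ρ, IsNondegenerate (Set.range π.hom)) :
    IsNondegenerate (Set.range (sumRep ρ).hom) := by
  intro ξ hξ
  ext π
  refine hρ π.1 π.2 (ξ π) ?_
  rintro _ ⟨x, rfl⟩
  exact congrArg (fun η : HilbertSum ρ => η π) (hξ _ ⟨x, rfl⟩)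

variable [T2Space S] [MeasurableSpace S] [BorelSpace S]

theorem commute_tilde {T : π.H →L[ℂ] π.H} (hT : T ∈ Set.centralizer (Set.range π.hom)) (μ : M S) :
    Commute (π.tilde μ) T := by
  ext ξ
  refine ext_inner_left ℂ fun η => ?_
  calc Inner.inner ℂ η (π.tilde μ (T ξ))
      = μ.integral fun x => Inner.inner ℂ η (π.hom x (T ξ)) := π.inner_tilde μ _ _
    _ = μ.integral fun x => Inner.inner ℂ (adjoint T η) (π.hom x ξ) := by
      refine congrArg μ.integral (funext fun x => ?_)
      rw [adjoint_inner_left]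
      exact congrArg _ (DFunLike.congr_fun (hT _ ⟨x, rfl⟩) ξ)
    _ = Inner.inner ℂ (adjoint T η) (π.tilde μ ξ) := (π.inner_tilde μ _ _).symm
    _ = Inner.inner ℂ η (T (π.tilde μ ξ)) := adjoint_inner_left ..

variable [ContinuousMul S]

theorem centralizer_range_hom (hS : IsFoundation S) (π : StarRep.{u, v} S) :
    Set.centralizer (Set.range π.hom) = Set.centralizer (π.tilde '' L S) := by
  refine Set.Subset.antisymm ?_ ?_
  · rintro T hT _ ⟨μ, -, rfl⟩
    exact commute_tilde hT μ
  · rintro T hT _ ⟨x, rfl⟩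
    ext ξ
    refine ext_inner_left ℂ fun η => ?_
    have hcoeff : π.coeff (T ξ) η = π.coeff ξ (adjoint T η) := by
      refine hS.eq_of_integral_eq fun μ hμ => ?_
      calc μ.integral (π.coeff (T ξ) η) = Inner.inner ℂ η (π.tilde μ (T ξ)) :=
            (π.inner_tilde μ _ _).symm
        _ = Inner.inner ℂ η (T (π.tilde μ ξ)) :=
            congrArg _ (DFunLike.congr_fun (hT _ ⟨μ, hμ, rfl⟩) ξ)
        _ = Inner.inner ℂ (adjoint T η) (π.tilde μ ξ) := (adjoint_inner_left ..).symm
        _ = μ.integral (π.coeff ξ (adjoint T η)) := π.inner_tilde μ _ _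
    exact (DFunLike.congr_fun hcoeff x).trans (adjoint_inner_left ..)

theorem isNondegenerate_tilde_image (hS : IsFoundation S)
    (hπ : IsNondegenerate (Set.range π.hom)) : IsNondegenerate (π.tilde '' L S) := by
  refine fun ξ hξ => hπ ξ ?_
  rintro _ ⟨x, rfl⟩
  refine ext_inner_left ℂ fun η => ?_
  rw [inner_zero_right]
  have hcoeff : π.coeff ξ η = 0 := by
    refine hS.eq_zero_of_integral_eq_zero fun μ hμ => ?_
    calc μ.integral (π.coeff ξ η) = Inner.inner ℂ η (π.tilde μ ξ) := (π.inner_tilde μ _ _).symm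
      _ = 0 := by rw [hξ _ ⟨μ, hμ, rfl⟩, inner_zero_right]
  exact DFunLike.congr_fun hcoeff x

end StarRep

end Representations

section UniversalAlgebras

variable {S : Type u} [TopologicalSpace S] [Mul S] [Star S]

/-- The representation `a ↦ ⊕_{π ∈ ρ} a_π` of the bounded product; its restriction to `C*(S)`
is `extend ρ`. -/
def productRep (ρ : Set (StarRep.{u, u} S)) :
    BoundedProduct S →⋆ₙₐ[ℂ] (HilbertSum ρ →L[ℂ] HilbertSum ρ) :=
  directSumHom
    (fun π : ρ =>
      { toFun := fun a => a π.1
        map_smul' := fun _ _ => rfl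
        map_zero' := rfl
        map_add' := fun _ _ => rfl
        map_mul' := fun _ _ => rfl
        map_star' := fun _ => rfl })
    fun π a => lp.norm_apply_le_norm ENNReal.top_ne_zero a π.1

theorem continuous_productRep (ρ : Set (StarRep.{u, u} S)) : Continuous (productRep ρ) :=
  continuous_directSumHom _ _

variable [T2Space S] [MeasurableSpace S] [BorelSpace S] [ContinuousMul S]

theorem tildeFamily_mem_CStar {μ : M S} (hμ : μ ∈ L S) : tildeFamily μ ∈ CStar S :=
  NonUnitalStarSubalgebra.le_topologicalClosure _
    (NonUnitalStarAlgebra.subset_adjoin ℂ _ ⟨μ, hμ, rfl⟩)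

variable (ρ : Set (StarRep.{u, u} S))

theorem coe_map_productRep :
    ((CStar S).map (productRep ρ) : Set (HilbertSum ρ →L[ℂ] HilbertSum ρ)) = cstarOps ρ := by
  ext T
  exact ⟨fun ⟨a, ha, h⟩ => ⟨⟨a, ha⟩, h⟩, fun ⟨a, h⟩ => ⟨a.1, a.2, h⟩⟩

theorem measureOps_subset_cstarOps : measureOps ρ ⊆ cstarOps ρ := by
  rintro _ ⟨μ, hμ, rfl⟩
  exact ⟨⟨_, tildeFamily_mem_CStar hμ⟩, extend_tildeFamily ρ μ _⟩

theorem CStar_le_comap_centralizer {T : HilbertSum ρ →L[ℂ] HilbertSum ρ}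
    (hT : T ∈ Set.centralizer (measureOps ρ)) (hTstar : star T ∈ Set.centralizer (measureOps ρ)) :
    CStar S ≤ (NonUnitalStarSubalgebra.centralizer ℂ {T}).comap (productRep ρ) := by
  refine NonUnitalStarSubalgebra.topologicalClosure_minimal _
    (NonUnitalStarAlgebra.adjoin_le ?_) ?_
  · rintro _ ⟨μ, hμ, rfl⟩
    change productRep ρ (tildeFamily μ) ∈ NonUnitalStarSubalgebra.centralizer ℂ {T}
    have hμρ : productRep ρ (tildeFamily μ) ∈ measureOps ρ :=
      ⟨μ, hμ, (extend_tildeFamily ρ μ (tildeFamily_mem_CStar hμ)).symm⟩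
    rw [NonUnitalStarSubalgebra.mem_centralizer_iff]
    rintro _ rfl
    exact ⟨(hT _ hμρ).symm, (hTstar _ hμρ).symm⟩
  · rw [NonUnitalStarSubalgebra.coe_comap, NonUnitalStarSubalgebra.coe_centralizer]
    exact (Set.isClosed_centralizer _).preimage (continuous_productRep ρ)

theorem centralizer_cstarOps (hS : IsFoundation S) :
    Set.centralizer (cstarOps ρ) = Set.centralizer (measureOps ρ) := by
  refine Set.Subset.antisymm (Set.centralizer_subset (measureOps_subset_cstarOps ρ)) fun T hT => ?_
  have hTstar : star T ∈ Set.centralizer (measureOps ρ) := by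
    rw [measureOps, ← StarRep.centralizer_range_hom hS] at hT ⊢
    exact StarRep.star_mem_centralizer_range_hom hT
  rintro _ ⟨a, rfl⟩
  have ha := CStar_le_comap_centralizer ρ hT hTstar a.2
  exact ((NonUnitalStarSubalgebra.mem_centralizer_iff ℂ).1 ha T rfl).1.symm

end UniversalAlgebras

end FoundationSemigroup

end

open FoundationSemigroup in
theorem proposition2p1_general {S : Type u} [Mul S] [Star S] [TopologicalSpace S] [T2Space S]
    [ContinuousMul S] [MeasurableSpace S] [BorelSpace S] (hfoundation : IsFoundation S)
    {ρ : Set (StarRep.{u, u} S)} (hρ : ∀ π ∈ ρ, IsNondegenerate (Set.range π.hom)) :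
    bicommutant (semigroupOps ρ) = bicommutant (measureOps ρ) ∧
      bicommutant (measureOps ρ) = bicommutant (cstarOps ρ) ∧
      bicommutant (cstarOps ρ) = WStar ρ := by
  have hsemigroup : Set.centralizer (semigroupOps ρ) = Set.centralizer (measureOps ρ) :=
    (sumRep ρ).centralizer_range_hom hfoundation
  have hcstar := centralizer_cstarOps ρ hfoundation
  have hnondeg : IsNondegenerate (cstarOps ρ) :=
    (StarRep.isNondegenerate_tilde_image hfoundation
      (StarRep.isNondegenerate_sumRep hρ)).mono (measureOps_subset_cstarOps ρ)
  refine ⟨by simp only [bicommutant, hsemigroup], by simp only [bicommutant, hcstar], ?_⟩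
  rw [← coe_map_productRep] at hnondeg
  rw [bicommutant, WStar, ← coe_map_productRep]
  exact bicommutant_eq_wotClosure hnondeg

open FoundationSemigroup in
theorem proposition2p1 {S : Type u} [Monoid S] [StarMul S]
    [TopologicalSpace S] [T2Space S] [LocallyCompactSpace S] [ContinuousMul S] [ContinuousStar S]
    [MeasurableSpace S] [BorelSpace S]
    (hfoundation : IsFoundation S) (hsep : SeparatesPoints S) :
    -- in the direct sum of all irreducible representations
    (bicommutant (semigroupOps (irreducibles S)) = bicommutant (measureOps (irreducibles S)) ∧
      bicommutant (measureOps (irreducibles S)) = bicommutant (cstarOps (irreducibles S)) ∧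
      bicommutant (cstarOps (irreducibles S)) = WStar (irreducibles S)) ∧
    -- in the direct sum of all cyclic representations
    (bicommutant (semigroupOps (cyclics S)) = bicommutant (measureOps (cyclics S)) ∧
      bicommutant (measureOps (cyclics S)) = bicommutant (cstarOps (cyclics S)) ∧
      bicommutant (cstarOps (cyclics S)) = WStar (cyclics S)) :=
  ⟨proposition2p1_general hfoundation fun _ h => StarRep.IsIrreducible.isNondegenerate h,
    proposition2p1_general hfoundation fun _ h => StarRep.IsCyclic.isNondegenerate h⟩
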